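/- For nonnegative integers $k,\ell,n$ let $H(k,\ell;n)$ be the set of partitions $\lambda=(\lambda_1\ge\lambda_2\ge\cdots)$ of $n$ with $\lambda_{k+1}\le \ell$ (that is, with at most $k$ parts greater than $\ell$). For a partition $\lambda$ of $n$ let $\chi^\lambda$ be the irreducible complex character of the symmetric group $S_n$ indexed by $\lambda$, let $\lambda'$ be the conjugate partition, and let $\otimes$ denote the product of characters given by the tensor product of representations with the diagonal action of $S_n$. There are unique coefficients $m_\lambda$ $(\lambda\vdash n)$ with $$\sum_{\mu\in H(k,\ell;n)}\chi^\mu\otimes\chi^\mu=\sum_{\lambda\vdash n} m_\lambda\,\chi^\lambda ,$$ and they are nonnegative integers. **Theorem.** $m_{(n)}$ equals the number of partitions in $H(k,\ell;n)$, and $m_{(1^n)}$ equals the number of self-conjugate partitions ($\lambda=\lambda'$) in $H(k,\ell;n)$. Moreover, if $n\ge 2$ and $(k,\ell)\ne(0,0)$, then $m_{(n)}\ne m_{(1^n)}$, and $\sum_\lambda m_\lambda\chi^\lambda$ is not symmetric under conjugation, i.e. $\sum_\lambda m_\lambda\chi^{\lambda'}\ne\sum_\lambda m_\lambda\chi^{\lambda}$.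 -/

import Mathlib

noncomputable section

namespace HookCharacters

open Finset

/-- The `i`-th part of a partition, its parts being listed in weakly decreasing order and indexed
from `0`; it is `0` beyond the last part. So `part lam i` is `λ_{i+1}`. -/
def part {n : ℕ} (lam : n.Partition) (i : ℕ) : ℕ :=
  (lam.parts.sort (· ≥ ·)).getD i 0

/-- The hook `H(k, l; n)`: the partitions `λ` of `n` with `λ_{k+1} ≤ l`. -/
def hook (k l n : ℕ) : Finset n.Partition :=
  {lam | part lam k ≤ l}

/-- The Young diagram of a partition. -/
def diagram {n : ℕ} (lam : n.Partition) : YoungDiagram :=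
  YoungDiagram.ofRowLens (lam.parts.sort (· ≥ ·)) (Multiset.pairwise_sort _ _).sortedGE

theorem card_cellsOfRowLens (w : List ℕ) :
    (YoungDiagram.cellsOfRowLens w).card = w.sum := by
  induction w with
  | nil => rfl
  | cons a w ih =>
    rw [YoungDiagram.cellsOfRowLens, Finset.card_union_of_disjoint]
    · simp [ih]
    · rw [Finset.disjoint_left]
      rintro ⟨i, j⟩ h1 h2
      simp at h1 h2
      omega

theorem card_diagram {n : ℕ} (lam : n.Partition) : (diagram lam).cells.card = n := by
  have h := congrArg Multiset.sum (Multiset.sort_eq lam.parts (· ≥ ·))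
  rw [Multiset.sum_coe, lam.parts_sum] at h
  exact (card_cellsOfRowLens _).trans h

theorem sum_rowLens (d : YoungDiagram) : d.rowLens.sum = d.cells.card := by
  rw [← card_cellsOfRowLens]
  exact congrArg (fun e : YoungDiagram => e.cells.card) (YoungDiagram.ofRowLens_to_rowLens_eq_self)

/-- The conjugate partition `λ'`: its parts are the lengths of the rows of the transposed Young
diagram. -/
def conj {n : ℕ} (lam : n.Partition) : n.Partition where
  parts := ((diagram lam).transpose.rowLens : Multiset ℕ)
  parts_pos := fun h => YoungDiagram.pos_of_mem_rowLens _ _ h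
  parts_sum := by
    rw [Multiset.sum_coe, sum_rowLens]
    refine Eq.trans ?_ (card_diagram lam)
    simp [YoungDiagram.transpose]

/-- The partition `(n)`. -/
def oneRow (n : ℕ) : n.Partition := Nat.Partition.indiscrete n

/-- The partition `(1^n)`. -/
def oneColumn (n : ℕ) : n.Partition where
  parts := Multiset.replicate n 1
  parts_pos := fun h => by simp [Multiset.eq_of_mem_replicate h]
  parts_sum := by simp

/-- The numberings of the cells of the Young diagram of `λ ⊢ n` by `Fin n`, each number being
used once. -/
abbrev Tableau {n : ℕ} (lam : n.Partition) : Type :=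
  (diagram lam).cells ≃ Fin n

/-- The permutations that preserve each row of the tableau `T`. -/
def rowStabilizer {n : ℕ} {lam : n.Partition} (T : Tableau lam) :
    Finset (Equiv.Perm (Fin n)) :=
  {p | ∀ i, (T.symm (p i)).1.1 = (T.symm i).1.1}

/-- The permutations that preserve each column of the tableau `T`. -/
def columnStabilizer {n : ℕ} {lam : n.Partition} (T : Tableau lam) :
    Finset (Equiv.Perm (Fin n)) :=
  {q | ∀ i, (T.symm (q i)).1.2 = (T.symm i).1.2}

/-- The complex group algebra of the symmetric group `S_n`. -/
abbrev GroupAlg (n : ℕ) : Type := MonoidAlgebra ℂ (Equiv.Perm (Fin n))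

/-- The Young symmetrizer of a tableau: the sum of the row permutations times the signed sum of
the column permutations. -/
def youngSymmetrizer {n : ℕ} {lam : n.Partition} (T : Tableau lam) : GroupAlg n :=
  (∑ p ∈ rowStabilizer T, MonoidAlgebra.single p 1) *
    ∑ q ∈ columnStabilizer T, MonoidAlgebra.single q ((Equiv.Perm.sign q : ℤ) : ℂ)

/-- A tableau of shape `λ`. The choice does not matter: other choices of the tableau give conjugate
Young symmetrizers, hence isomorphic left ideals and the same character. -/
def tableau {n : ℕ} (lam : n.Partition) : Tableau lam :=
  Fintype.equivFinOfCardEq ((Fintype.card_coe _).trans (card_diagram lam))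

/-- The Specht module of `λ ⊢ n`, as the left ideal of the group algebra generated by the Young
symmetrizer of a tableau of shape `λ`. -/
abbrev Specht {n : ℕ} (lam : n.Partition) : Submodule (GroupAlg n) (GroupAlg n) :=
  Submodule.span (GroupAlg n) {youngSymmetrizer (tableau lam)}

/-- The irreducible representation of `S_n` on the Specht module, by left multiplication. -/
def spechtRep {n : ℕ} (lam : n.Partition) :
    Representation ℂ (Equiv.Perm (Fin n)) (Specht lam) :=
  Representation.ofModule' (Specht lam)

/-- The irreducible character `χ^λ` of `S_n`. -/
def chi {n : ℕ} (lam : n.Partition) : Equiv.Perm (Fin n) → ℂ :=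
  (spechtRep lam).character

/-- The character `χ^μ ⊗ χ^ν` of the (inner) tensor product of two irreducible representations
of `S_n`, with the diagonal action. -/
def chiTensor {n : ℕ} (mu nu : n.Partition) : Equiv.Perm (Fin n) → ℂ :=
  Representation.character (V := TensorProduct ℂ (Specht mu) (Specht nu))
    ((spechtRep mu).tprod (spechtRep nu))

/-- `m` is a family of coefficients `m_λ` with
`∑_{μ ∈ H(k, l; n)} χ^μ ⊗ χ^μ = ∑_{λ ⊢ n} m_λ χ^λ`. -/
def IsMultiplicities (k l : ℕ) {n : ℕ} (m : n.Partition → ℂ) : Prop :=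
  ∑ mu ∈ hook k l n, chiTensor mu mu = ∑ lam, m lam • chi lam

end HookCharacters

end

/-!
Write `c` for the Young symmetrizer of a tableau `T` of shape `λ`. The combinatorial input is that two
tableaux `T` of shape `λ` and `S` of shape `μ`, such that no two numbers share a row of `T` and a column
of `S`, force `∑ (i - 1) λ_i ≥ ∑ (i - 1) μ_i`, with equality only when `λ = μ` and the numbers can be
moved within the rows of `T` to their columns of `S` (`image_rowOf_colOf_eq_cells`). Two numbers that
do share a row of `T` and a column of `S` give a transposition that kills the product of the row sum of
`T` with the signed column sum of `S`. Hence `c x c` is always a multiple of `c`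
(`youngSymmetrizer_mul_mul`), and `c_λ x c_μ = 0` for `λ ≠ μ`, in one of the two orders
(`youngSymmetrizer_mul_mul_eq_zero`).

A multiple `e` of `c` is therefore idempotent, and `χ^λ(g) = ∑ e(h⁻¹ g⁻¹ h)`, summed over `h`
(`chi_eq_idealChar`). With this formula the orthonormality of the `χ^λ` (`pairing_chi`) is a statement
about coefficients of products in the group algebra, and does not need irreducibility. As a
permutation is conjugate to its inverse, the pairing `(n!)⁻¹ ∑ f₁(g) f₂(g)` without complex conjugation
can be used. Counting conjugacy classes shows that the `χ^λ` form a basis of the class functions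
(`eq_sum_pairing_smul_chi`). The multiplicity of `χ^λ` in a character is the trace of `e`, that is, the
rank of a projection, hence a natural number (`exists_pairing_character_chi_eq_natCast`).

Comparing the coefficients of `c` for `T` and for its reflection gives `χ^{λ'} = sgn · χ^λ`
(`chi_conj`), and `χ^{(n)} = 1`, `χ^{(1^n)} = sgn`. So the multiplicity of `χ^{(n)}` in `χ^μ ⊗ χ^μ` is
`⟨χ^μ, χ^μ⟩ = 1`, and that of `χ^{(1^n)}` is `⟨χ^μ, χ^{μ'}⟩`, which is `1` or `0` according to whether
`μ = μ'`. For `n ≥ 2` and `(k, l) ≠ (0, 0)` the hook contains `(n)` or `(1^n)`, which are not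
self-conjugate, so the two multiplicities differ. Conjugating all partitions multiplies
`∑ m_λ χ^λ` by the sign and so exchanges these two multiplicities, which rules out symmetry.
-/

noncomputable section

namespace HookCharacters

open Finset

/-! ### Traces on the group algebra and on its left ideals -/

section GroupAlgebra

variable {G : Type*} [Group G] [Fintype G]

theorem eq_sum_single {G : Type*} [Fintype G] (x : MonoidAlgebra ℂ G) :
    x = ∑ g, MonoidAlgebra.single g (x.coeff g) := by
  conv_lhs => rw [← MonoidAlgebra.sum_coeff_single x]
  exact Finsupp.sum_fintype _ _ fun _ => MonoidAlgebra.single_zero _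

theorem coeff_mul_eq_sum (x y : MonoidAlgebra ℂ G) (g : G) :
    (x * y).coeff g = ∑ h, x.coeff h * y.coeff (h⁻¹ * g) := by
  conv_lhs => rw [eq_sum_single x, Finset.sum_mul]
  simp [MonoidAlgebra.coeff_sum, Finsupp.finsetSum_apply]

theorem coeff_mul_one (x y : MonoidAlgebra ℂ G) :
    (x * y).coeff 1 = ∑ g, x.coeff g * y.coeff g⁻¹ := by
  simp [coeff_mul_eq_sum]

theorem trace_mulLeftRight (g : G) (b : MonoidAlgebra ℂ G) :
    LinearMap.trace ℂ (MonoidAlgebra ℂ G)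
      (LinearMap.mulLeft ℂ (MonoidAlgebra.single g 1) ∘ₗ LinearMap.mulRight ℂ b) =
      ∑ h, b.coeff (h⁻¹ * g⁻¹ * h) := by
  classical
  rw [LinearMap.trace_eq_matrix_trace ℂ (MonoidAlgebra.basis G ℂ), Matrix.trace]
  refine Finset.sum_congr rfl fun h _ => ?_
  rw [Matrix.diag_apply, LinearMap.toMatrix_apply]
  simp [MonoidAlgebra.basis, mul_assoc]

/-- The function `g ↦ ∑ h, e (h⁻¹ g⁻¹ h)`; for an idempotent `e` it is the character of the left
ideal generated by `e`. -/
def idealChar (e : MonoidAlgebra ℂ G) (g : G) : ℂ :=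
  ∑ h, e.coeff (h⁻¹ * g⁻¹ * h)

/-- Right multiplication by an idempotent `e` projects the group algebra onto `I = A e`, so the trace
of `g` on `I` is the trace of `x ↦ g x e` on the whole group algebra. -/
theorem character_ofModule' (I : Submodule (MonoidAlgebra ℂ G) (MonoidAlgebra ℂ G))
    (e : MonoidAlgebra ℂ G) (heI : e ∈ I) (he : ∀ x ∈ I, x * e = x) (g : G) :
    (Representation.ofModule' I).character g = idealChar e g := by
  let ι : I →ₗ[ℂ] MonoidAlgebra ℂ G := I.subtype.restrictScalars ℂ
  let π : MonoidAlgebra ℂ G →ₗ[ℂ] I :=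
    { toFun := fun x => ⟨x * e, I.smul_mem x heI⟩
      map_add' := fun x y => Subtype.ext (add_mul x y e)
      map_smul' := fun c x => Subtype.ext (smul_mul_assoc c x e) }
  have hfin : FiniteDimensional ℂ (MonoidAlgebra ℂ G) :=
    (MonoidAlgebra.basis G ℂ).finiteDimensional_of_finite
  have hI : FiniteDimensional ℂ I :=
    FiniteDimensional.of_injective ι Subtype.val_injective
  have h1 : (Representation.ofModule' I g : I →ₗ[ℂ] I) =
      π ∘ₗ (LinearMap.mulLeft ℂ (MonoidAlgebra.single g 1) ∘ₗ ι) := by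
    refine LinearMap.ext fun x => Subtype.ext ?_
    have : ((Representation.ofModule' (k := ℂ) (G := G) I g x : I) : MonoidAlgebra ℂ G)
        = MonoidAlgebra.single g 1 * (x : MonoidAlgebra ℂ G) := by
      simp [Representation.ofModule']
    rw [this]
    exact (he _ (I.smul_mem _ x.2)).symm
  rw [Representation.character, h1, LinearMap.trace_comp_comm', LinearMap.comp_assoc]
  exact trace_mulLeftRight g e

theorem trace_asAlgebraHom {V : Type*} [AddCommGroup V] [Module ℂ V]
    (ρ : Representation ℂ G V) (x : MonoidAlgebra ℂ G) :
    LinearMap.trace ℂ V (ρ.asAlgebraHom x) = ∑ g, ρ.character g * x.coeff g := by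
  conv_lhs => rw [eq_sum_single x]
  simp [Representation.character, mul_comm]

/-- An idempotent acts on a representation as a projection, whose trace is its rank. -/
theorem exists_trace_asAlgebraHom_eq_natCast {V : Type*} [AddCommGroup V] [Module ℂ V]
    [FiniteDimensional ℂ V] (ρ : Representation ℂ G V) {e : MonoidAlgebra ℂ G}
    (he : IsIdempotentElem e) : ∃ m : ℕ, ∑ g, ρ.character g * e.coeff g = m :=
  ⟨_, (trace_asAlgebraHom ρ e).symm.trans
    (LinearMap.IsIdempotentElem.isProj_range _ (he.map ρ.asAlgebraHom)).trace⟩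

end GroupAlgebra

/-! ### The pairing of functions on a group -/

section ClassFunction

section Pairing

variable {G : Type*} [Fintype G]

/-- The bilinear pairing `|G|⁻¹ ∑ f₁(g) f₂(g)`; it is the usual scalar product of characters when
every element of `G` is conjugate to its inverse. -/
def pairing : (G → ℂ) →ₗ[ℂ] (G → ℂ) →ₗ[ℂ] ℂ :=
  LinearMap.mk₂ ℂ (fun f₁ f₂ => (Fintype.card G : ℂ)⁻¹ * ∑ g, f₁ g * f₂ g)
    (fun _ _ _ => by simp [add_mul, sum_add_distrib, mul_add])
    (fun c _ _ => by simp [mul_sum, mul_assoc, mul_left_comm c])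
    (fun _ _ _ => by simp [sum_add_distrib, mul_add])
    (fun c _ _ => by simp [mul_sum, mul_left_comm c])

theorem pairing_apply (f₁ f₂ : G → ℂ) :
    pairing f₁ f₂ = (Fintype.card G : ℂ)⁻¹ * ∑ g, f₁ g * f₂ g := rfl

theorem pairing_comm (f₁ f₂ : G → ℂ) : pairing f₁ f₂ = pairing f₂ f₁ := by
  simp only [pairing_apply, mul_comm]

theorem pairing_mul_left (f₁ f₂ f₃ : G → ℂ) : pairing (f₁ * f₂) f₃ = pairing f₁ (f₂ * f₃) := by
  simp only [pairing_apply, Pi.mul_apply, mul_assoc]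

end Pairing

variable {G : Type*} [Group G] [Fintype G]

/-- The average over `G` in `idealChar e` is absorbed by a class function `f`. The hypothesis on `f`
also contains invariance under `g ↦ g⁻¹`. -/
theorem pairing_idealChar (f : G → ℂ) (hf : ∀ g h, f (h * g⁻¹ * h⁻¹) = f g)
    (e : MonoidAlgebra ℂ G) : pairing f (idealChar e) = ∑ g, f g * e.coeff g := by
  have hG : (Fintype.card G : ℂ) ≠ 0 := Nat.cast_ne_zero.2 Fintype.card_ne_zero
  have key : ∀ h : G, ∑ g, f g * e.coeff (h⁻¹ * g⁻¹ * h) = ∑ g, f g * e.coeff g := by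
    intro h
    refine Fintype.sum_equiv ((Equiv.inv G).trans (MulAut.conj h⁻¹).toEquiv) _ _ fun g => ?_
    have := hf (h⁻¹ * g⁻¹ * h) h
    simp [mul_assoc] at this ⊢
    rw [← this]; simp
  simp only [pairing_apply, idealChar, mul_sum]
  rw [sum_comm]
  simp only [← mul_sum, key]
  simp [hG]

theorem sum_idealChar_mul_coeff (e₁ e₂ : MonoidAlgebra ℂ G) :
    ∑ g, idealChar e₁ g * e₂.coeff g =
      ∑ h, (e₂ * (MonoidAlgebra.single h 1 * e₁ * MonoidAlgebra.single h⁻¹ 1)).coeff 1 := by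
  simp only [coeff_mul_one, idealChar, sum_mul]
  rw [sum_comm]
  simp [mul_comm, mul_assoc]

end ClassFunction

/-! ### Young diagrams of partitions -/

section Diagrams

theorem diagram_injective {n : ℕ} : Function.Injective (diagram (n := n)) := by
  intro lam mu h
  have key : ∀ nu : n.Partition, (diagram nu).rowLens = nu.parts.sort (· ≥ ·) := fun nu =>
    YoungDiagram.rowLens_ofRowLens_eq_self fun x hx => nu.parts_pos ((Multiset.mem_sort _).1 hx)
  have h2 : lam.parts.sort (· ≥ ·) = mu.parts.sort (· ≥ ·) := by rw [← key, ← key, h]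
  exact Nat.Partition.ext (by rw [← Multiset.sort_eq lam.parts (· ≥ ·), h2, Multiset.sort_eq])

theorem diagram_conj {n : ℕ} (lam : n.Partition) :
    diagram (conj lam) = (diagram lam).transpose := by
  have h : (conj lam).parts.sort (· ≥ ·) = (diagram lam).transpose.rowLens :=
    List.mergeSort_of_pairwise (by simpa using (YoungDiagram.rowLens_sorted _).pairwise)
  refine Eq.trans ?_ (YoungDiagram.ofRowLens_to_rowLens_eq_self (μ := (diagram lam).transpose))
  simp only [diagram, h]

end Diagrams

/-! ### Numbers sharing a row of one tableau and a column of another -/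

section Collisions

variable {n : ℕ} {lam mu : n.Partition}

/-- The row of the tableau `T` that contains the number `i`. -/
def rowOf (T : Tableau lam) (i : Fin n) : ℕ := (T.symm i).1.1

/-- The column of the tableau `T` that contains the number `i`. -/
def colOf (T : Tableau lam) (i : Fin n) : ℕ := (T.symm i).1.2

theorem mem_rowStabilizer {T : Tableau lam} {p : Equiv.Perm (Fin n)} :
    p ∈ rowStabilizer T ↔ ∀ i, rowOf T (p i) = rowOf T i := by
  simp [rowStabilizer, rowOf]

theorem mem_columnStabilizer {T : Tableau lam} {q : Equiv.Perm (Fin n)} :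
    q ∈ columnStabilizer T ↔ ∀ i, colOf T (q i) = colOf T i := by
  simp [columnStabilizer, colOf]

theorem eq_of_rowOf_eq_of_colOf_eq {T : Tableau lam} {i j : Fin n} (hr : rowOf T i = rowOf T j)
    (hc : colOf T i = colOf T j) : i = j :=
  T.symm.injective (Subtype.ext (Prod.ext hr hc))

theorem sum_cells_eq_sum {M : Type*} [AddCommMonoid M] (T : Tableau lam) (f : ℕ × ℕ → M) :
    ∑ x ∈ (diagram lam).cells, f x = ∑ i, f (rowOf T i, colOf T i) := by
  rw [← Finset.sum_coe_sort]
  exact Fintype.sum_equiv T _ _ fun x => by simp [rowOf, colOf]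

/-- `∑ (i - 1) λ_i`, the sum of the row indices of the cells. -/
def rowWeight (lam : n.Partition) : ℕ := ∑ x ∈ (diagram lam).cells, x.1

/-- If no two numbers share a row of `T` and a column of `S`, and the row weight of the shape of `T`
is at most that of `S`, then the cells (row in `T`, column in `S`) fill the diagram of `S`. Each
column of `S` places its numbers in distinct rows, and the sum of these rows is least when they
are the topmost ones. -/
theorem image_rowOf_colOf_eq_cells (T : Tableau lam) (S : Tableau mu)
    (hw : rowWeight lam ≤ rowWeight mu)
    (hinj : ∀ i j, rowOf T i = rowOf T j → colOf S i = colOf S j → i = j) :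
    univ.image (fun i => (rowOf T i, colOf S i)) = (diagram mu).cells := by
  set f : Fin n → ℕ × ℕ := fun i => (rowOf T i, colOf S i) with hf
  have finj : Function.Injective f := fun i j h =>
    hinj i j (Prod.ext_iff.1 h).1 (Prod.ext_iff.1 h).2
  set F := univ.image f with hF
  -- This weight is negative exactly on the cells of `mu`, so among all sets with the cardinality of
  -- the diagram, the diagram itself is the only one of least total weight.
  let w : ℕ × ℕ → ℤ := fun x => (x.1 : ℤ) - (diagram mu).colLen x.2
  have hneg : ∀ x, x ∈ (diagram mu).cells ↔ w x < 0 := fun x => by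
    rw [YoungDiagram.mem_cells, ← Prod.mk.eta (p := x), YoungDiagram.mem_iff_lt_colLen]
    simp [w]
  have hsum : ∑ x ∈ F, w x ≤ ∑ x ∈ (diagram mu).cells, w x := by
    rw [hF, Finset.sum_image fun i _ j _ h => finj h]
    simp only [w, Finset.sum_sub_distrib]
    have h1 := sum_cells_eq_sum T fun x => (x.1 : ℤ)
    have h2 := sum_cells_eq_sum S fun x => ((diagram mu).colLen x.2 : ℤ)
    have h3 : (rowWeight lam : ℤ) ≤ rowWeight mu := by exact_mod_cast hw
    simp only [rowWeight, Nat.cast_sum] at h3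
    simp only [hf]
    linarith
  have hsub : (diagram mu).cells ⊆ F := by
    by_contra hcon
    obtain ⟨x, hx, hxF⟩ := Finset.not_subset.1 hcon
    have h1 : ∑ y ∈ (diagram mu).cells, w y < ∑ y ∈ (diagram mu).cells ∩ F, w y := by
      rw [← Finset.sum_inter_add_sum_sdiff (diagram mu).cells F w]
      have : ∑ y ∈ (diagram mu).cells \ F, w y < 0 :=
        Finset.sum_neg (fun y hy => (hneg y).1 (Finset.mem_sdiff.1 hy).1)
          ⟨x, Finset.mem_sdiff.2 ⟨hx, hxF⟩⟩
      linarith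
    have h2 : ∑ y ∈ (diagram mu).cells ∩ F, w y ≤ ∑ y ∈ F, w y :=
      Finset.sum_le_sum_of_subset_of_nonneg Finset.inter_subset_right fun y hy hy' => by
        by_contra hlt
        exact hy' (Finset.mem_inter.2 ⟨(hneg y).2 (not_le.1 hlt), hy⟩)
    linarith
  refine (Finset.eq_of_subset_of_card_le hsub ?_).symm
  rw [card_diagram, hF, Finset.card_image_of_injective _ finj, Finset.card_univ, Fintype.card_fin]

theorem exists_row_column_collision (hne : lam ≠ mu) (hw : rowWeight lam ≤ rowWeight mu)
    (T : Tableau lam) (S : Tableau mu) :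
    ∃ i j, i ≠ j ∧ rowOf T i = rowOf T j ∧ colOf S i = colOf S j := by
  by_contra! hcon
  have hinj : ∀ i j, rowOf T i = rowOf T j → colOf S i = colOf S j → i = j := fun i j h1 h2 =>
    by_contra fun h => hcon i j h h1 h2
  have himg := image_rowOf_colOf_eq_cells T S hw hinj
  refine hne (diagram_injective (YoungDiagram.ext ?_))
  have hrow : ∀ r, (diagram lam).rowLen r = (diagram mu).rowLen r := by
    intro r
    have h1 : ∀ nu : n.Partition, (diagram nu).rowLen r =
        ∑ x ∈ (diagram nu).cells, if x.1 = r then 1 else 0 := fun nu => by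
      rw [YoungDiagram.rowLen_eq_card, YoungDiagram.row, Finset.card_filter]
    rw [h1, h1, sum_cells_eq_sum T, ← himg, Finset.sum_image]
    exact fun i _ j _ h => hinj i j (Prod.ext_iff.1 h).1 (Prod.ext_iff.1 h).2
  ext ⟨i, j⟩
  rw [YoungDiagram.mem_cells, YoungDiagram.mem_cells, YoungDiagram.mem_iff_lt_rowLen,
    YoungDiagram.mem_iff_lt_rowLen, hrow]

/-- The tableau `gT`, in which each number `i` of `T` is replaced by `g i`. -/
def relabel (g : Equiv.Perm (Fin n)) (T : Tableau lam) : Tableau lam := T.trans g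

theorem rowOf_relabel (g : Equiv.Perm (Fin n)) (T : Tableau lam) (i : Fin n) :
    rowOf (relabel g T) i = rowOf T (g⁻¹ i) := rfl

theorem colOf_relabel (g : Equiv.Perm (Fin n)) (T : Tableau lam) (i : Fin n) :
    colOf (relabel g T) i = colOf T (g⁻¹ i) := rfl

theorem inv_mem_rowStabilizer {T : Tableau lam} {p : Equiv.Perm (Fin n)}
    (hp : p ∈ rowStabilizer T) : p⁻¹ ∈ rowStabilizer T :=
  mem_rowStabilizer.2 fun i => by simpa using (mem_rowStabilizer.1 hp (p⁻¹ i)).symm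

theorem inv_mem_columnStabilizer {T : Tableau lam} {q : Equiv.Perm (Fin n)}
    (hq : q ∈ columnStabilizer T) : q⁻¹ ∈ columnStabilizer T :=
  mem_columnStabilizer.2 fun i => by simpa using (mem_columnStabilizer.1 hq (q⁻¹ i)).symm

theorem mul_mem_columnStabilizer_cancel_left {T : Tableau lam} {q x : Equiv.Perm (Fin n)}
    (hq : q ∈ columnStabilizer T) : q * x ∈ columnStabilizer T ↔ x ∈ columnStabilizer T := by
  simp [mem_columnStabilizer, mem_columnStabilizer.1 hq]

theorem mul_mem_rowStabilizer_cancel_right {T : Tableau lam} {p x : Equiv.Perm (Fin n)}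
    (hp : p ∈ rowStabilizer T) : x * p ∈ rowStabilizer T ↔ x ∈ rowStabilizer T := by
  simp only [mem_rowStabilizer, Equiv.Perm.mul_apply]
  refine ⟨fun h i => ?_, fun h i => (h (p i)).trans (mem_rowStabilizer.1 hp i)⟩
  simpa using (h (p⁻¹ i)).trans (mem_rowStabilizer.1 (inv_mem_rowStabilizer hp) i)

/-- Without collisions between `T` and `gT`, moving every number `i` within its row of `T` to its
column of `gT` is a row permutation `p` of `T`, and `p g` preserves the columns of `T`. -/
theorem exists_eq_mul_of_no_collision (T : Tableau lam) (g : Equiv.Perm (Fin n))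
    (hinj : ∀ i j, rowOf T i = rowOf T j → colOf (relabel g T) i = colOf (relabel g T) j → i = j) :
    ∃ p ∈ rowStabilizer T, ∃ q ∈ columnStabilizer T, g = p * q := by
  have himg := image_rowOf_colOf_eq_cells T (relabel g T) le_rfl hinj
  have hmem : ∀ i, (rowOf T i, colOf (relabel g T) i) ∈ (diagram lam).cells := fun i => by
    rw [← himg]; exact Finset.mem_image_of_mem _ (Finset.mem_univ i)
  let f : Fin n → Fin n := fun i => T ⟨(rowOf T i, colOf (relabel g T) i), hmem i⟩
  have hf : Function.Injective f := fun i j h => by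
    have := congrArg Subtype.val (T.injective h)
    exact hinj i j (Prod.ext_iff.1 this).1 (Prod.ext_iff.1 this).2
  let p : Equiv.Perm (Fin n) := Equiv.ofBijective f (Finite.injective_iff_bijective.1 hf)
  have hp : p ∈ rowStabilizer T := mem_rowStabilizer.2 fun i => by
    simp [p, f, rowOf]
  have hpg : p * g ∈ columnStabilizer T := mem_columnStabilizer.2 fun i => by
    simp [p, f, colOf, relabel]
  exact ⟨p⁻¹, inv_mem_rowStabilizer hp, p * g, hpg, by simp⟩

end Collisions

/-! ### Idempotents with a one-dimensional corner -/

section QuasiIdempotent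

variable {G : Type*} [Group G] [Fintype G]

/-- The multiple `κ⁻¹ • c` of `c`, where `κ` is the coefficient of `1` in `c * c`. It is idempotent
when `c * c = κ • c` with `κ ≠ 0`. -/
def normalize (c : MonoidAlgebra ℂ G) : MonoidAlgebra ℂ G := ((c * c).coeff 1)⁻¹ • c

theorem mul_mul_eq_coeff_smul {G : Type*} [Group G] {c : MonoidAlgebra ℂ G}
    (hc : ∀ x, ∃ r : ℂ, c * x * c = r • c) (h1 : c.coeff 1 = 1)
    (x : MonoidAlgebra ℂ G) :
    c * x * c = (c * x * c).coeff 1 • c := by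
  obtain ⟨r, hr⟩ := hc x
  rw [hr, MonoidAlgebra.coeff_smul_apply, h1, smul_eq_mul, mul_one]

variable {c : MonoidAlgebra ℂ G}

theorem mul_self_eq_coeff_smul {G : Type*} [Group G] {c : MonoidAlgebra ℂ G}
    (hc : ∀ x, ∃ r : ℂ, c * x * c = r • c) (h1 : c.coeff 1 = 1) :
    c * c = (c * c).coeff 1 • c := by
  simpa using mul_mul_eq_coeff_smul hc h1 1

/-- If `c * c` vanished, right multiplication by `c` would be nilpotent, but its trace is
`|G| c(1)`. -/
theorem coeff_mul_self_ne_zero (hc : ∀ x, ∃ r : ℂ, c * x * c = r • c) (h1 : c.coeff 1 = 1) :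
    (c * c).coeff 1 ≠ 0 := by
  intro h0
  have hsq : c * c = 0 := by rw [mul_self_eq_coeff_smul hc h1, h0, zero_smul]
  have hfin : FiniteDimensional ℂ (MonoidAlgebra ℂ G) :=
    (MonoidAlgebra.basis G ℂ).finiteDimensional_of_finite
  have hnil : IsNilpotent (LinearMap.mulRight ℂ c) :=
    ⟨2, LinearMap.ext fun x => by simp [pow_two, mul_assoc, hsq]⟩
  have htr := (LinearMap.isNilpotent_trace_of_isNilpotent hnil).eq_zero
  have h2 := trace_mulLeftRight 1 c
  have h3 : LinearMap.mulLeft ℂ (MonoidAlgebra.single (1 : G) (1 : ℂ)) = LinearMap.id := by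
    rw [← MonoidAlgebra.one_def, LinearMap.mulLeft_one]
  rw [h3, LinearMap.id_comp, htr] at h2
  simp [h1, eq_comm] at h2

theorem isIdempotentElem_normalize (hc : ∀ x, ∃ r : ℂ, c * x * c = r • c) (h1 : c.coeff 1 = 1) :
    IsIdempotentElem (normalize c) := by
  have hk := coeff_mul_self_ne_zero hc h1
  rw [IsIdempotentElem, normalize, smul_mul_smul_comm, mul_self_eq_coeff_smul hc h1, smul_smul,
    ← mul_self_eq_coeff_smul hc h1]
  congr 1
  field_simp

theorem mem_span_mul_normalize (hc : ∀ x, ∃ r : ℂ, c * x * c = r • c) (h1 : c.coeff 1 = 1)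
    {x : MonoidAlgebra ℂ G}
    (hx : x ∈ Submodule.span (MonoidAlgebra ℂ G) {c}) : x * normalize c = x := by
  obtain ⟨y, rfl⟩ := Submodule.mem_span_singleton.1 hx
  have hk := coeff_mul_self_ne_zero hc h1
  have h2 : c * normalize c = c := by
    rw [normalize, mul_smul_comm, inv_smul_eq_iff₀ hk]
    exact mul_self_eq_coeff_smul hc h1
  rw [smul_eq_mul, mul_assoc, h2]

theorem character_span (hc : ∀ x, ∃ r : ℂ, c * x * c = r • c) (h1 : c.coeff 1 = 1)
    (g : G) :
    (Representation.ofModule' (k := ℂ) (G := G)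
      (Submodule.span (MonoidAlgebra ℂ G) {c})).character g = idealChar (normalize c) g := by
  refine character_ofModule' _ _ ?_ (fun x hx => mem_span_mul_normalize hc h1 hx) g
  have : normalize c = (MonoidAlgebra.single 1 ((c * c).coeff 1)⁻¹ : MonoidAlgebra ℂ G) • c := by
    rw [smul_eq_mul, normalize]
    ext g
    simp
  rw [this]
  exact Submodule.smul_mem _ _ (Submodule.mem_span_singleton_self c)

/-- With `c h c = φ(h) c`, the sum is `κ⁻² ∑ φ(h) c(h)`, and `∑ φ(h) c(h)` is the coefficient of `1` in
`c * c * c = κ² c`. -/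
theorem sum_idealChar_normalize_self (hc : ∀ x, ∃ r : ℂ, c * x * c = r • c) (h1 : c.coeff 1 = 1)
    :
    ∑ g, idealChar (normalize c) g * (normalize c).coeff g = 1 := by
  have hk := coeff_mul_self_ne_zero hc h1
  rw [sum_idealChar_mul_coeff]
  have h2 : ∀ h : G, (c * (MonoidAlgebra.single h 1 * c * MonoidAlgebra.single h⁻¹ 1)).coeff 1 =
      (c * MonoidAlgebra.single h (c.coeff h) * c).coeff 1 := by
    intro h
    have h3 : MonoidAlgebra.single h (c.coeff h) = c.coeff h • MonoidAlgebra.single h (1 : ℂ) := by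
      simp
    rw [← mul_assoc, ← mul_assoc, mul_mul_eq_coeff_smul hc h1, h3, mul_smul_comm, smul_mul_assoc,
      MonoidAlgebra.coeff_smul_apply]
    simp [mul_comm]
  have h4 : ∑ h : G, (c * (MonoidAlgebra.single h 1 * c * MonoidAlgebra.single h⁻¹ 1)).coeff 1 =
      (c * c).coeff 1 * (c * c).coeff 1 := by
    simp only [h2]
    have h5 : c * c * c = ∑ h, c * MonoidAlgebra.single h (c.coeff h) * c := by
      rw [← Finset.sum_mul, ← Finset.mul_sum, ← eq_sum_single]
    have h6 : (c * c * c).coeff 1 = (c * c).coeff 1 * (c * c).coeff 1 := by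
      conv_lhs => rw [mul_self_eq_coeff_smul hc h1]
      simp
    rw [← h6, h5]
    simp only [MonoidAlgebra.coeff_sum, Finsupp.finsetSum_apply]
  calc _ = ((c * c).coeff 1)⁻¹ * ((c * c).coeff 1)⁻¹ *
        ∑ h : G, (c * (MonoidAlgebra.single h 1 * c * MonoidAlgebra.single h⁻¹ 1)).coeff 1 := by
        simp only [normalize, Finset.mul_sum, smul_mul_assoc, mul_smul_comm,
          MonoidAlgebra.coeff_smul_apply, smul_eq_mul, mul_assoc]
    _ = 1 := by rw [h4]; field_simp

end QuasiIdempotent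

/-! ### Young symmetrizers -/

section YoungSymmetrizer

variable {n : ℕ} {lam mu : n.Partition}

/-- The sum of the row permutations of `T`. -/
def rowSum (T : Tableau lam) : GroupAlg n := ∑ p ∈ rowStabilizer T, MonoidAlgebra.single p 1

/-- The signed sum of the column permutations of `T`. -/
def columnSum (T : Tableau lam) : GroupAlg n :=
  ∑ q ∈ columnStabilizer T, MonoidAlgebra.single q ((Equiv.Perm.sign q : ℤ) : ℂ)

theorem youngSymmetrizer_eq (T : Tableau lam) : youngSymmetrizer T = rowSum T * columnSum T := rfl

open Classical in
theorem coeff_rowSum (T : Tableau lam) (g : Equiv.Perm (Fin n)) :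
    (rowSum T).coeff g = if g ∈ rowStabilizer T then 1 else 0 := by
  simp [rowSum, MonoidAlgebra.coeff_sum, Finsupp.finsetSum_apply, Finsupp.single_apply]

open Classical in
theorem coeff_columnSum (T : Tableau lam) (g : Equiv.Perm (Fin n)) :
    (columnSum T).coeff g =
      if g ∈ columnStabilizer T then ((Equiv.Perm.sign g : ℤ) : ℂ) else 0 := by
  simp [columnSum, MonoidAlgebra.coeff_sum, Finsupp.finsetSum_apply, Finsupp.single_apply]

theorem rowSum_mul_single (T : Tableau lam) {p : Equiv.Perm (Fin n)} (hp : p ∈ rowStabilizer T) :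
    rowSum T * MonoidAlgebra.single p 1 = rowSum T := by
  ext g
  simp [coeff_rowSum, mul_mem_rowStabilizer_cancel_right (inv_mem_rowStabilizer hp)]

theorem single_mul_columnSum (T : Tableau lam) {q : Equiv.Perm (Fin n)}
    (hq : q ∈ columnStabilizer T) :
    MonoidAlgebra.single q 1 * columnSum T = ((Equiv.Perm.sign q : ℤ) : ℂ) • columnSum T := by
  ext g
  simp [coeff_columnSum, mul_mem_columnStabilizer_cancel_left (inv_mem_columnStabilizer hq)]

/-- The transposition of the two numbers is absorbed by the row sum of `T`, and changes the sign of the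
column sum of `S`. -/
theorem rowSum_mul_columnSum_eq_zero (T : Tableau lam) (S : Tableau mu) {i j : Fin n}
    (hij : i ≠ j) (hr : rowOf T i = rowOf T j) (hc : colOf S i = colOf S j) :
    rowSum T * columnSum S = 0 := by
  have h1 : Equiv.swap i j ∈ rowStabilizer T := mem_rowStabilizer.2 fun k => by
    by_cases hi : k = i
    · simp [hi, hr]
    by_cases hj : k = j
    · simp [hj, hr]
    rw [Equiv.swap_apply_of_ne_of_ne hi hj]
  have h2 : Equiv.swap i j ∈ columnStabilizer S := mem_columnStabilizer.2 fun k => by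
    by_cases hi : k = i
    · simp [hi, hc]
    by_cases hj : k = j
    · simp [hj, hc]
    rw [Equiv.swap_apply_of_ne_of_ne hi hj]
  have h3 : rowSum T * columnSum S = -(rowSum T * columnSum S) := by
    conv_lhs => rw [← rowSum_mul_single T h1, mul_assoc, single_mul_columnSum S h2]
    simp [Equiv.Perm.sign_swap hij]
  have h4 : (2 : ℂ) • (rowSum T * columnSum S) = 0 := by
    rw [two_smul]; nth_rewrite 1 [h3]; exact neg_add_cancel _
  exact (smul_eq_zero.1 h4).resolve_left two_ne_zero

theorem mem_rowStabilizer_relabel {g x : Equiv.Perm (Fin n)} {T : Tableau lam} :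
    x ∈ rowStabilizer (relabel g T) ↔ g⁻¹ * x * g ∈ rowStabilizer T := by
  simp only [mem_rowStabilizer, rowOf_relabel, Equiv.Perm.mul_apply]
  refine ⟨fun h i => by simpa using h (g i), fun h i => by simpa using h (g⁻¹ i)⟩

theorem mem_columnStabilizer_relabel {g x : Equiv.Perm (Fin n)} {T : Tableau lam} :
    x ∈ columnStabilizer (relabel g T) ↔ g⁻¹ * x * g ∈ columnStabilizer T := by
  simp only [mem_columnStabilizer, colOf_relabel, Equiv.Perm.mul_apply]
  refine ⟨fun h i => by simpa using h (g i), fun h i => by simpa using h (g⁻¹ i)⟩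

theorem rowSum_relabel (g : Equiv.Perm (Fin n)) (T : Tableau lam) :
    rowSum (relabel g T) = MonoidAlgebra.single g 1 * rowSum T * MonoidAlgebra.single g⁻¹ 1 := by
  ext x
  simp [coeff_rowSum, mem_rowStabilizer_relabel, mul_assoc]

theorem columnSum_relabel (g : Equiv.Perm (Fin n)) (T : Tableau lam) :
    columnSum (relabel g T) =
      MonoidAlgebra.single g 1 * columnSum T * MonoidAlgebra.single g⁻¹ 1 := by
  ext x
  simp [coeff_columnSum, mem_columnStabilizer_relabel, mul_assoc, mul_comm (Equiv.Perm.sign g)]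

theorem youngSymmetrizer_relabel (g : Equiv.Perm (Fin n)) (T : Tableau lam) :
    youngSymmetrizer (relabel g T) =
      MonoidAlgebra.single g 1 * youngSymmetrizer T * MonoidAlgebra.single g⁻¹ 1 := by
  have h : MonoidAlgebra.single g⁻¹ (1 : ℂ) * MonoidAlgebra.single g 1 = 1 := by
    simp [MonoidAlgebra.one_def]
  rw [youngSymmetrizer_eq, rowSum_relabel, columnSum_relabel, youngSymmetrizer_eq]
  simp only [mul_assoc]
  rw [← mul_assoc (MonoidAlgebra.single g⁻¹ (1 : ℂ)), h, one_mul]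

theorem single_mul_columnSum_eq (g : Equiv.Perm (Fin n)) (T : Tableau lam) :
    MonoidAlgebra.single g 1 * columnSum T =
      columnSum (relabel g T) * MonoidAlgebra.single g 1 := by
  rw [columnSum_relabel, mul_assoc, MonoidAlgebra.single_mul_single]
  simp [← MonoidAlgebra.one_def]

theorem rowSum_mul_single_mul_columnSum (T : Tableau lam) (g : Equiv.Perm (Fin n)) :
    ∃ r : ℂ, rowSum T * MonoidAlgebra.single g 1 * columnSum T = r • youngSymmetrizer T := by
  by_cases hinj : ∀ i j, rowOf T i = rowOf T j →
      colOf (relabel g T) i = colOf (relabel g T) j → i = j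
  · obtain ⟨p, hp, q, hq, rfl⟩ := exists_eq_mul_of_no_collision T g hinj
    refine ⟨((Equiv.Perm.sign q : ℤ) : ℂ), ?_⟩
    have h : MonoidAlgebra.single (p * q) (1 : ℂ) =
        MonoidAlgebra.single p 1 * MonoidAlgebra.single q 1 := by simp
    rw [h, ← mul_assoc, rowSum_mul_single T hp, mul_assoc, single_mul_columnSum T hq,
      mul_smul_comm, youngSymmetrizer_eq]
  · push Not at hinj
    obtain ⟨i, j, hr, hc, hij⟩ := hinj
    refine ⟨0, ?_⟩
    rw [mul_assoc, single_mul_columnSum_eq, ← mul_assoc,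
      rowSum_mul_columnSum_eq_zero T _ hij hr hc, zero_mul, zero_smul]

theorem rowSum_mul_mul_columnSum (T : Tableau lam) (x : GroupAlg n) :
    ∃ r : ℂ, rowSum T * x * columnSum T = r • youngSymmetrizer T := by
  choose r hr using rowSum_mul_single_mul_columnSum T
  refine ⟨∑ g, x.coeff g * r g, ?_⟩
  conv_lhs => rw [eq_sum_single x, Finset.mul_sum, Finset.sum_mul]
  rw [Finset.sum_smul]
  refine Finset.sum_congr rfl fun g _ => ?_
  have h : MonoidAlgebra.single g (x.coeff g) = x.coeff g • MonoidAlgebra.single g (1 : ℂ) := by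
    simp
  rw [h, mul_smul_comm, smul_mul_assoc, hr, smul_smul]

theorem youngSymmetrizer_mul_mul (T : Tableau lam) (x : GroupAlg n) :
    ∃ r : ℂ, youngSymmetrizer T * x * youngSymmetrizer T = r • youngSymmetrizer T := by
  obtain ⟨r, hr⟩ := rowSum_mul_mul_columnSum T (columnSum T * x * rowSum T)
  exact ⟨r, by rw [← hr, youngSymmetrizer_eq]; simp only [mul_assoc]⟩

theorem rowSum_mul_mul_columnSum_eq_zero (hne : lam ≠ mu) (hw : rowWeight lam ≤ rowWeight mu)
    (T : Tableau lam) (S : Tableau mu) (x : GroupAlg n) : rowSum T * x * columnSum S = 0 := by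
  rw [eq_sum_single x, Finset.mul_sum, Finset.sum_mul]
  refine Finset.sum_eq_zero fun g _ => ?_
  have h : MonoidAlgebra.single g (x.coeff g) = x.coeff g • MonoidAlgebra.single g (1 : ℂ) := by
    simp
  obtain ⟨i, j, hij, hr, hc⟩ := exists_row_column_collision hne hw T (relabel g S)
  rw [h, mul_smul_comm, smul_mul_assoc, mul_assoc, single_mul_columnSum_eq, ← mul_assoc,
    rowSum_mul_columnSum_eq_zero T _ hij hr hc, zero_mul, smul_zero]

theorem youngSymmetrizer_mul_mul_eq_zero (hne : lam ≠ mu) (hw : rowWeight lam ≤ rowWeight mu)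
    (T : Tableau lam) (S : Tableau mu) (x : GroupAlg n) :
    youngSymmetrizer T * x * youngSymmetrizer S = 0 := by
  have h := rowSum_mul_mul_columnSum_eq_zero hne hw T S (columnSum T * x * rowSum S)
  rw [← h, youngSymmetrizer_eq, youngSymmetrizer_eq]
  simp only [mul_assoc]

theorem coeff_youngSymmetrizer_one (T : Tableau lam) : (youngSymmetrizer T).coeff 1 = 1 := by
  classical
  rw [youngSymmetrizer_eq, coeff_mul_eq_sum, Finset.sum_eq_single 1]
  · simp [coeff_rowSum, coeff_columnSum, mem_rowStabilizer, mem_columnStabilizer]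
  · intro g _ hg
    by_cases hr : g ∈ rowStabilizer T
    · by_cases hc : g⁻¹ * 1 ∈ columnStabilizer T
      · rw [mul_one] at hc
        have hc' := inv_mem_columnStabilizer hc
        rw [inv_inv] at hc'
        refine absurd (Equiv.ext fun i => ?_) hg
        exact eq_of_rowOf_eq_of_colOf_eq (mem_rowStabilizer.1 hr i) (mem_columnStabilizer.1 hc' i)
      · rw [coeff_columnSum, if_neg hc, mul_zero]
    · rw [coeff_rowSum, if_neg hr, zero_mul]
  · simp

theorem chi_eq_idealChar (lam : n.Partition) :
    chi lam = idealChar (normalize (youngSymmetrizer (tableau lam))) :=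
  funext fun g => character_span (youngSymmetrizer_mul_mul _) (coeff_youngSymmetrizer_one _) g

end YoungSymmetrizer

/-! ### Conjugation of idempotents -/

section IdealChar

variable {G : Type*} [Group G] [Fintype G]

theorem idealChar_conj (e : MonoidAlgebra ℂ G) (g k : G) :
    idealChar e (k * g * k⁻¹) = idealChar e g :=
  Fintype.sum_equiv (Equiv.mulLeft k⁻¹) _ _ fun h => by simp [mul_assoc]

theorem idealChar_single_mul_mul_single (e : MonoidAlgebra ℂ G) (k : G) :
    idealChar (MonoidAlgebra.single k 1 * e * MonoidAlgebra.single k⁻¹ 1) = idealChar e :=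
  funext fun g => Fintype.sum_equiv (Equiv.mulRight k) _ _ fun h => by simp [mul_assoc]

theorem normalize_single_mul_mul_single {G : Type*} [Group G] (c : MonoidAlgebra ℂ G) (k : G) :
    normalize (MonoidAlgebra.single k 1 * c * MonoidAlgebra.single k⁻¹ 1) =
      MonoidAlgebra.single k 1 * normalize c * MonoidAlgebra.single k⁻¹ 1 := by
  have h : MonoidAlgebra.single k⁻¹ (1 : ℂ) * MonoidAlgebra.single k 1 = 1 := by
    simp [MonoidAlgebra.one_def]
  have h2 : MonoidAlgebra.single k 1 * c * MonoidAlgebra.single k⁻¹ 1 *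
      (MonoidAlgebra.single k 1 * c * MonoidAlgebra.single k⁻¹ 1) =
      MonoidAlgebra.single k 1 * (c * c) * MonoidAlgebra.single k⁻¹ (1 : ℂ) := by
    simp only [mul_assoc]
    rw [← mul_assoc (MonoidAlgebra.single k⁻¹ (1 : ℂ)), h, one_mul]
  rw [normalize, normalize, h2, mul_smul_comm, smul_mul_assoc]
  simp

theorem map_conj_inv {G : Type*} [Group G] (ε : G →* ℤˣ) (g h : G) : ε (h⁻¹ * g⁻¹ * h) = ε g := by
  rcases Int.units_eq_one_or (ε g) with h1 | h1 <;> simp [h1]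

end IdealChar

/-! ### The irreducible characters of the symmetric group -/

section Characters

variable {n : ℕ}

theorem isConj_inv_self (g : Equiv.Perm (Fin n)) : IsConj g⁻¹ g :=
  Equiv.Perm.isConj_iff_cycleType_eq.2 (Equiv.Perm.cycleType_inv g)

theorem chi_eq_of_isConj (lam : n.Partition) {g h : Equiv.Perm (Fin n)} (hgh : IsConj g h) :
    chi lam g = chi lam h := by
  obtain ⟨k, rfl⟩ := isConj_iff.1 hgh
  rw [chi_eq_idealChar, idealChar_conj]

/-- The functions on `S_n` that are constant on conjugacy classes. -/
def classFunctions (n : ℕ) : Submodule ℂ (Equiv.Perm (Fin n) → ℂ) where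
  carrier := {f | ∀ g h, IsConj g h → f g = f h}
  add_mem' := fun hf hf' g h hgh => congrArg₂ (· + ·) (hf g h hgh) (hf' g h hgh)
  zero_mem' := fun _ _ _ => rfl
  smul_mem' := fun c _ hf g h hgh => congrArg (c • ·) (hf g h hgh)

theorem chi_mem_classFunctions (lam : n.Partition) : chi lam ∈ classFunctions n :=
  fun _ _ h => chi_eq_of_isConj lam h

theorem mul_mem_classFunctions {f f' : Equiv.Perm (Fin n) → ℂ} (hf : f ∈ classFunctions n)
    (hf' : f' ∈ classFunctions n) : f * f' ∈ classFunctions n :=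
  fun g h hgh => congrArg₂ (· * ·) (hf g h hgh) (hf' g h hgh)

theorem pairing_chi_eq_sum {f : Equiv.Perm (Fin n) → ℂ} (hf : f ∈ classFunctions n)
    (lam : n.Partition) :
    pairing f (chi lam) = ∑ g, f g * (normalize (youngSymmetrizer (tableau lam))).coeff g := by
  rw [chi_eq_idealChar]
  refine pairing_idealChar f (fun g h => ?_) _
  exact (hf _ _ (isConj_iff.2 ⟨h, rfl⟩)).symm.trans (hf _ _ (isConj_inv_self g))

theorem pairing_chi_self (lam : n.Partition) : pairing (chi lam) (chi lam) = 1 := by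
  rw [pairing_chi_eq_sum (chi_mem_classFunctions lam), chi_eq_idealChar]
  exact sum_idealChar_normalize_self (youngSymmetrizer_mul_mul _) (coeff_youngSymmetrizer_one _)

/-- The scalar product is symmetric, so only the order of `λ` and `μ` in which the collision argument
applies has to be treated. -/
theorem pairing_chi_of_ne {lam mu : n.Partition} (hne : lam ≠ mu) :
    pairing (chi lam) (chi mu) = 0 := by
  wlog hw : rowWeight mu ≤ rowWeight lam generalizing lam mu
  · rw [pairing_comm]
    exact this hne.symm (le_of_not_ge hw)
  rw [pairing_chi_eq_sum (chi_mem_classFunctions lam), chi_eq_idealChar, sum_idealChar_mul_coeff]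
  refine Finset.sum_eq_zero fun h _ => ?_
  have h0 := youngSymmetrizer_mul_mul_eq_zero hne.symm hw (tableau mu) (tableau lam)
    (MonoidAlgebra.single h 1)
  simp only [normalize, ← mul_assoc, smul_mul_assoc, mul_smul_comm, h0]
  simp

theorem pairing_chi (lam mu : n.Partition) [Decidable (lam = mu)] :
    pairing (chi lam) (chi mu) = if lam = mu then 1 else 0 := by
  split_ifs with h
  · rw [h, pairing_chi_self]
  · exact pairing_chi_of_ne h

theorem pairing_sum_smul_chi (m : n.Partition → ℂ) (mu : n.Partition) :
    pairing (∑ lam, m lam • chi lam) (chi mu) = m mu := by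
  classical
  simp [pairing_chi]

theorem finrank_classFunctions_le :
    Module.finrank ℂ (classFunctions n) ≤ Fintype.card n.Partition := by
  let P := (Fintype.card (Fin n)).Partition
  have hle : classFunctions n ≤
      LinearMap.range (LinearMap.funLeft ℂ ℂ (Equiv.Perm.partition (α := Fin n))) := by
    intro f hf
    have hfac : f.FactorsThrough (Equiv.Perm.partition (α := Fin n)) := fun g h hgh =>
      hf g h (Equiv.Perm.partition_eq_of_isConj.2 hgh)
    obtain ⟨F, hF⟩ := (Function.factorsThrough_iff f).1 hfac
    exact ⟨F, hF.symm⟩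
  calc _ ≤ _ := Submodule.finrank_mono hle
    _ ≤ Module.finrank ℂ (P → ℂ) := LinearMap.finrank_range_le _
    _ = Fintype.card n.Partition := by
      rw [Module.finrank_fintype_fun_eq_card]
      simp only [P, Fintype.card_fin]

/-- The orthonormal family of the `χ^λ` has as many members as there are conjugacy classes, so it spans
the class functions. -/
theorem eq_sum_pairing_smul_chi {f : Equiv.Perm (Fin n) → ℂ} (hf : f ∈ classFunctions n) :
    f = ∑ lam, pairing f (chi lam) • chi lam := by
  have hli : LinearIndependent ℂ (chi (n := n)) := by
    rw [Fintype.linearIndependent_iff]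
    intro m hm mu
    rw [← pairing_sum_smul_chi m mu, hm]
    simp
  have hspan : Submodule.span ℂ (Set.range (chi (n := n))) = classFunctions n := by
    refine Submodule.eq_of_le_of_finrank_le ?_ ?_
    · rw [Submodule.span_le]
      rintro _ ⟨lam, rfl⟩
      exact chi_mem_classFunctions lam
    · rw [finrank_span_eq_card hli]
      exact finrank_classFunctions_le
  rw [← hspan, Submodule.mem_span_range_iff_exists_fun] at hf
  obtain ⟨m, rfl⟩ := hf
  simp only [pairing_sum_smul_chi]

/-- The sign character of `S_n`. -/
def signChar (n : ℕ) : Equiv.Perm (Fin n) → ℂ := fun g => ((Equiv.Perm.sign g : ℤ) : ℂ)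

theorem signChar_mul_self : signChar n * signChar n = 1 := by
  funext g
  rcases Int.units_eq_one_or (Equiv.Perm.sign g) with h | h <;> simp [signChar, h]

/-- The tableau of shape `λ'` obtained from a tableau of shape `λ` by reflection in the main
diagonal. -/
def transposeTableau {lam : n.Partition} (T : Tableau lam) : Tableau (conj lam) :=
  ((Equiv.prodComm ℕ ℕ).subtypeEquiv fun x => by
    rw [diagram_conj, YoungDiagram.mem_cells, YoungDiagram.mem_cells,
      YoungDiagram.mem_transpose]; exact Iff.rfl).trans T

theorem rowStabilizer_transposeTableau {lam : n.Partition} (T : Tableau lam) :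
    rowStabilizer (transposeTableau T) = columnStabilizer T := by
  ext p; rw [mem_rowStabilizer, mem_columnStabilizer]; rfl

theorem columnStabilizer_transposeTableau {lam : n.Partition} (T : Tableau lam) :
    columnStabilizer (transposeTableau T) = rowStabilizer T := by
  ext p; rw [mem_rowStabilizer, mem_columnStabilizer]; rfl

/-- Reflection exchanges row and column stabilizers. Inversion restores the order of the two factors,
and the sign moves from one factor to the other. -/
theorem coeff_youngSymmetrizer_transposeTableau {lam : n.Partition} (T : Tableau lam)
    (g : Equiv.Perm (Fin n)) :
    (youngSymmetrizer (transposeTableau T)).coeff g =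
      signChar n g * (youngSymmetrizer T).coeff g⁻¹ := by
  classical
  rw [youngSymmetrizer_eq, youngSymmetrizer_eq, coeff_mul_eq_sum, coeff_mul_eq_sum, mul_sum]
  refine Fintype.sum_equiv ((Equiv.inv _).trans (Equiv.mulRight g) |>.trans (Equiv.inv _)) _ _
    fun x => ?_
  have h1 : ∀ y : Equiv.Perm (Fin n), y⁻¹ ∈ rowStabilizer T ↔ y ∈ rowStabilizer T := fun y =>
    ⟨fun h => by simpa using inv_mem_rowStabilizer h, inv_mem_rowStabilizer⟩
  have h2 : (x⁻¹ * g)⁻¹⁻¹ * g⁻¹ = x⁻¹ := by group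
  have h3 : x⁻¹ ∈ columnStabilizer T ↔ x ∈ columnStabilizer T :=
    ⟨fun h => by simpa using inv_mem_columnStabilizer h, inv_mem_columnStabilizer⟩
  have h4 : signChar n (x⁻¹ * g) = signChar n g * signChar n x⁻¹ := by
    simp [signChar, mul_comm]
  simp only [coeff_rowSum, coeff_columnSum, rowStabilizer_transposeTableau,
    columnStabilizer_transposeTableau, Equiv.trans_apply, Equiv.inv_apply,
    Equiv.coe_mulRight, h1, h2, h3]
  simp only [signChar] at h4 ⊢
  rw [h4]
  split_ifs <;> simp

theorem normalize_youngSymmetrizer_transposeTableau {lam : n.Partition} (T : Tableau lam)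
    (g : Equiv.Perm (Fin n)) :
    (normalize (youngSymmetrizer (transposeTableau T))).coeff g =
      signChar n g * (normalize (youngSymmetrizer T)).coeff g⁻¹ := by
  have h : ∀ x : Equiv.Perm (Fin n), signChar n x * signChar n x⁻¹ = 1 := fun x => by
    simpa [signChar] using congrFun (signChar_mul_self (n := n)) x
  have hk : (youngSymmetrizer (transposeTableau T) * youngSymmetrizer (transposeTableau T)).coeff 1
      = (youngSymmetrizer T * youngSymmetrizer T).coeff 1 := by
    rw [coeff_mul_one, coeff_mul_one]
    refine Finset.sum_congr rfl fun x _ => ?_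
    rw [coeff_youngSymmetrizer_transposeTableau, coeff_youngSymmetrizer_transposeTableau, inv_inv]
    linear_combination
      ((youngSymmetrizer T).coeff x⁻¹ * (youngSymmetrizer T).coeff x) * h x
  rw [normalize, normalize, hk, MonoidAlgebra.coeff_smul_apply, MonoidAlgebra.coeff_smul_apply,
    coeff_youngSymmetrizer_transposeTableau, smul_eq_mul, smul_eq_mul, mul_left_comm]

/-- Any tableau of shape `λ` can be used to compute `χ^λ`. -/
theorem chi_eq_idealChar_of_tableau {lam : n.Partition} (T : Tableau lam) :
    chi lam = idealChar (normalize (youngSymmetrizer T)) := by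
  have hT : T = relabel ((tableau lam).symm.trans T) (tableau lam) :=
    Equiv.ext fun x => by simp [relabel]
  rw [hT, youngSymmetrizer_relabel, normalize_single_mul_mul_single,
    idealChar_single_mul_mul_single, chi_eq_idealChar]

theorem chi_conj (lam : n.Partition) : chi (conj lam) = signChar n * chi lam := by
  funext g
  rw [chi_eq_idealChar_of_tableau (transposeTableau (tableau lam)), Pi.mul_apply,
    ← chi_eq_of_isConj lam (isConj_inv_self g), chi_eq_idealChar, idealChar, idealChar, mul_sum]
  refine Finset.sum_congr rfl fun h _ => ?_
  rw [normalize_youngSymmetrizer_transposeTableau]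
  have h1 : signChar n (h⁻¹ * g⁻¹ * h) = signChar n g := by
    rw [signChar, map_conj_inv, signChar]
  rw [h1]
  simp [mul_assoc]

theorem chi_eq_of_coeff {lam : n.Partition} (ε : Equiv.Perm (Fin n) →* ℤˣ)
    (h : ∀ g, (youngSymmetrizer (tableau lam)).coeff g = ((ε g : ℤ) : ℂ)) :
    chi lam = fun g => ((ε g : ℤ) : ℂ) := by
  have hk : (youngSymmetrizer (tableau lam) * youngSymmetrizer (tableau lam)).coeff 1 =
      Fintype.card (Equiv.Perm (Fin n)) := by
    rw [coeff_mul_one]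
    have : ∀ g, ((ε g : ℤ) : ℂ) * ((ε g⁻¹ : ℤ) : ℂ) = 1 := fun g => by
      rw [← Int.cast_mul, ← Units.val_mul, ← map_mul]; simp
    simp only [h, this, sum_const, card_univ, nsmul_eq_mul, mul_one]
  have hG : (Fintype.card (Equiv.Perm (Fin n)) : ℂ) ≠ 0 :=
    Nat.cast_ne_zero.2 Fintype.card_ne_zero
  funext g
  rw [chi_eq_idealChar, idealChar]
  have h2 : ∀ k, (normalize (youngSymmetrizer (tableau lam))).coeff (k⁻¹ * g⁻¹ * k) =
      (Fintype.card (Equiv.Perm (Fin n)) : ℂ)⁻¹ * ((ε g : ℤ) : ℂ) := fun k => by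
    rw [normalize, hk, MonoidAlgebra.coeff_smul_apply, h, smul_eq_mul]
    rw [map_conj_inv]
  simp only [h2, sum_const, card_univ, nsmul_eq_mul]
  rw [mul_inv_cancel_left₀ hG]

theorem diagram_fst_oneRow {x : ℕ × ℕ} (hx : x ∈ (diagram (oneRow n)).cells) : x.1 = 0 := by
  rw [YoungDiagram.mem_cells, diagram, YoungDiagram.mem_ofRowLens] at hx
  obtain ⟨h, -⟩ := hx
  rw [Multiset.length_sort] at h
  rcases Nat.eq_zero_or_pos n with rfl | hn
  · simp [oneRow] at h
  · simp [oneRow, Nat.Partition.indiscrete_parts hn.ne'] at h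
    exact h

theorem diagram_snd_oneColumn {x : ℕ × ℕ} (hx : x ∈ (diagram (oneColumn n)).cells) :
    x.2 = 0 := by
  rw [YoungDiagram.mem_cells, diagram, YoungDiagram.mem_ofRowLens] at hx
  obtain ⟨h, hlt⟩ := hx
  have h1 : ∀ y ∈ (oneColumn n).parts.sort (· ≥ ·), y = 1 := fun y hy =>
    Multiset.eq_of_mem_replicate ((Multiset.mem_sort _).1 hy)
  have := h1 _ (List.getElem_mem h)
  omega

theorem chi_oneRow : chi (oneRow n) = 1 := by
  classical
  have hr : ∀ i, rowOf (tableau (oneRow n)) i = 0 := fun i => diagram_fst_oneRow (Subtype.prop _)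
  have hc : ∀ g, g ∈ columnStabilizer (tableau (oneRow n)) ↔ g = 1 := fun g =>
    ⟨fun h => Equiv.ext fun i => eq_of_rowOf_eq_of_colOf_eq (by rw [hr, hr])
      (mem_columnStabilizer.1 h i), fun h => by simp [h, mem_columnStabilizer]⟩
  rw [chi_eq_of_coeff 1 fun g => ?_]
  · funext g; simp
  · rw [youngSymmetrizer_eq, coeff_mul_eq_sum, Finset.sum_eq_single g]
    · simp [coeff_rowSum, coeff_columnSum, hc, mem_rowStabilizer, hr]
    · intro x _ hx
      rw [coeff_columnSum, if_neg (by rw [hc, inv_mul_eq_one]; exact hx), mul_zero]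
    · simp

theorem chi_oneColumn : chi (oneColumn n) = signChar n := by
  classical
  have hc : ∀ i, colOf (tableau (oneColumn n)) i = 0 := fun i =>
    diagram_snd_oneColumn (Subtype.prop _)
  have hr : ∀ g, g ∈ rowStabilizer (tableau (oneColumn n)) ↔ g = 1 := fun g =>
    ⟨fun h => Equiv.ext fun i => eq_of_rowOf_eq_of_colOf_eq (mem_rowStabilizer.1 h i)
      (by rw [hc, hc]), fun h => by simp [h, mem_rowStabilizer]⟩
  rw [chi_eq_of_coeff Equiv.Perm.sign fun g => ?_]
  · rfl
  · rw [youngSymmetrizer_eq, coeff_mul_eq_sum, Finset.sum_eq_single 1]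
    · simp [coeff_rowSum, coeff_columnSum, hr, mem_columnStabilizer, hc]
    · intro x _ hx
      rw [coeff_rowSum, if_neg (by rwa [hr]), zero_mul]
    · simp

instance finiteDimensional_specht (lam : n.Partition) : FiniteDimensional ℂ (Specht lam) := by
  have hfin : FiniteDimensional ℂ (GroupAlg n) :=
    (MonoidAlgebra.basis (Equiv.Perm (Fin n)) ℂ).finiteDimensional_of_finite
  exact FiniteDimensional.of_injective ((Specht lam).subtype.restrictScalars ℂ)
    Subtype.val_injective

theorem chiTensor_eq_mul (mu nu : n.Partition) : chiTensor mu nu = chi mu * chi nu :=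
  Representation.char_tensor (spechtRep mu) (spechtRep nu)

theorem exists_pairing_character_chi_eq_natCast {V : Type*} [AddCommGroup V] [Module ℂ V]
    [FiniteDimensional ℂ V] (ρ : Representation ℂ (Equiv.Perm (Fin n)) V) (lam : n.Partition) :
    ∃ m : ℕ, pairing ρ.character (chi lam) = m := by
  have hf : ρ.character ∈ classFunctions n := fun g h hgh => by
    obtain ⟨k, rfl⟩ := isConj_iff.1 hgh
    exact (ρ.char_conj g k).symm
  rw [pairing_chi_eq_sum hf]
  exact exists_trace_asAlgebraHom_eq_natCast ρ
    (isIdempotentElem_normalize (youngSymmetrizer_mul_mul _) (coeff_youngSymmetrizer_one _))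

theorem exists_pairing_chiTensor_chi_eq_natCast (mu nu lam : n.Partition) :
    ∃ m : ℕ, pairing (chiTensor mu nu) (chi lam) = m := by
  unfold chiTensor
  apply exists_pairing_character_chi_eq_natCast

end Characters

/-! ### Partitions in a hook that are not self-conjugate -/

section Hooks

variable {n : ℕ}

theorem one_ne_signChar (hn : 2 ≤ n) : (1 : Equiv.Perm (Fin n) → ℂ) ≠ signChar n := by
  intro h
  have hne : (⟨0, by omega⟩ : Fin n) ≠ ⟨1, by omega⟩ := by simp
  have h1 := congrFun h (Equiv.swap ⟨0, by omega⟩ ⟨1, by omega⟩)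
  simp only [signChar, Equiv.Perm.sign_swap hne, Pi.one_apply] at h1
  norm_num at h1

theorem conj_oneRow_ne (hn : 2 ≤ n) : conj (oneRow n) ≠ oneRow n := fun h => by
  have h1 := chi_conj (oneRow n)
  rw [h, chi_oneRow, mul_one] at h1
  exact one_ne_signChar hn h1

theorem conj_oneColumn_ne (hn : 2 ≤ n) : conj (oneColumn n) ≠ oneColumn n := fun h => by
  have h1 := chi_conj (oneColumn n)
  rw [h, chi_oneColumn, signChar_mul_self] at h1
  exact one_ne_signChar hn h1.symm

theorem exists_mem_hook_conj_ne {k l : ℕ} (hn : 2 ≤ n) (hkl : (k, l) ≠ (0, 0)) :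
    ∃ lam ∈ hook k l n, conj lam ≠ lam := by
  rcases Nat.eq_zero_or_pos k with rfl | hk
  · have hl : 1 ≤ l := Nat.one_le_iff_ne_zero.2 fun h => hkl (by rw [h])
    refine ⟨oneColumn n, ?_, conj_oneColumn_ne hn⟩
    have h1 : part (oneColumn n) 0 ≤ 1 := by
      rw [part]
      by_cases h : 0 < ((oneColumn n).parts.sort (· ≥ ·)).length
      · rw [List.getD_eq_getElem _ _ h]
        exact (Multiset.eq_of_mem_replicate ((Multiset.mem_sort _).1 (List.getElem_mem h))).le
      · rw [List.getD_eq_default _ _ (not_lt.1 h)]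
        exact zero_le_one
    simp only [hook, mem_filter, mem_univ, true_and]
    exact h1.trans hl
  · refine ⟨oneRow n, ?_, conj_oneRow_ne hn⟩
    have h1 : part (oneRow n) k = 0 := by
      rw [part, List.getD_eq_default]
      rw [Multiset.length_sort, oneRow, Nat.Partition.indiscrete_parts (by omega)]
      simpa using Nat.one_le_iff_ne_zero.2 hk.ne'
    simp [hook, h1]

end Hooks

end HookCharacters

end

open HookCharacters Finset in
/-- For all `k, l, n` the multiplicities `m_λ` in `∑_{μ ∈ H(k, l; n)} χ^μ ⊗ χ^μ = ∑ m_λ χ^λ` are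
well defined, `m_{(n)}` is the number of partitions in `H(k, l; n)`, and `m_{(1^n)}` is the number
of self-conjugate ones. If `n ≥ 2` and `(k, l) ≠ (0, 0)` these two multiplicities differ, and
`∑ m_λ χ^λ` is not symmetric under conjugation of partitions. -/
theorem theorem4p2 (k l n : ℕ) :
    ∃ m : n.Partition → ℕ,
      HookCharacters.IsMultiplicities k l (fun lam => (m lam : ℂ)) ∧
      (∀ m' : n.Partition → ℂ,
        HookCharacters.IsMultiplicities k l m' → m' = fun lam => (m lam : ℂ)) ∧
      m (HookCharacters.oneRow n) = (HookCharacters.hook k l n).card ∧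
      m (HookCharacters.oneColumn n) =
        ((HookCharacters.hook k l n).filter (fun lam => HookCharacters.conj lam = lam)).card ∧
      (2 ≤ n → (k, l) ≠ (0, 0) →
        m (HookCharacters.oneRow n) ≠ m (HookCharacters.oneColumn n) ∧
        ∑ lam, (m lam : ℂ) • HookCharacters.chi (HookCharacters.conj lam) ≠
          ∑ lam, (m lam : ℂ) • HookCharacters.chi lam) := by
  choose m0 hm0 using fun mu lam : n.Partition => exists_pairing_chiTensor_chi_eq_natCast mu mu lam
  let m : n.Partition → ℕ := fun lam => ∑ mu ∈ hook k l n, m0 mu lam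
  have hpair : ∀ lam, pairing (∑ mu ∈ hook k l n, chiTensor mu mu) (chi lam) = (m lam : ℂ) :=
    fun lam => by simp [m, hm0]
  have hmul : IsMultiplicities k l (fun lam => (m lam : ℂ)) := by
    have hf : ∑ mu ∈ hook k l n, chiTensor mu mu ∈ classFunctions n :=
      Submodule.sum_mem _ fun mu _ => by
        rw [chiTensor_eq_mul]
        exact mul_mem_classFunctions (chi_mem_classFunctions mu) (chi_mem_classFunctions mu)
    have h := eq_sum_pairing_smul_chi hf
    simp only [hpair] at h
    exact h
  have hrow : m (oneRow n) = (hook k l n).card := by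
    have h := hpair (oneRow n)
    simp only [map_sum, LinearMap.sum_apply, chiTensor_eq_mul, pairing_mul_left, chi_oneRow,
      mul_one, pairing_chi_self, sum_const, nsmul_eq_mul] at h
    exact_mod_cast h.symm
  -- `χ^μ χ^μ` paired with the sign is `χ^μ` paired with `χ^{μ'}`.
  have hcol : m (oneColumn n) = ((hook k l n).filter (fun lam => conj lam = lam)).card := by
    have h := hpair (oneColumn n)
    simp only [map_sum, LinearMap.sum_apply, chiTensor_eq_mul, pairing_mul_left, chi_oneColumn,
      mul_comm _ (signChar n), ← chi_conj, pairing_chi, eq_comm (b := conj _)] at h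
    rw [Finset.sum_boole] at h
    exact_mod_cast h.symm
  have hne : 2 ≤ n → (k, l) ≠ (0, 0) → m (oneRow n) ≠ m (oneColumn n) := by
    intro hn hkl h
    obtain ⟨lam, hlam, hconj⟩ := exists_mem_hook_conj_ne hn hkl
    rw [hrow, hcol, eq_comm, Finset.card_filter_eq_iff] at h
    exact hconj (h lam hlam)
  refine ⟨m, hmul, fun m' hm' => ?_, hrow, hcol, fun hn hkl => ⟨hne hn hkl, fun h => ?_⟩⟩
  · funext lam
    rw [← pairing_sum_smul_chi m' lam, ← hm', hpair]
  · have h1 : ∑ lam, (m lam : ℂ) • chi (conj lam) =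
        (∑ lam, (m lam : ℂ) • chi lam) * signChar n := by
      simp only [Finset.sum_mul, chi_conj, mul_comm (signChar n), smul_mul_assoc]
    have h2 := pairing_sum_smul_chi (fun lam => (m lam : ℂ)) (oneColumn n)
    rw [← h, h1, pairing_mul_left, chi_oneColumn, signChar_mul_self, ← chi_oneRow,
      pairing_sum_smul_chi] at h2
    exact hne hn hkl (by exact_mod_cast h2)
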